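/- **Theorem 1.3.** Let $\mathbb{N}=\{0,1,2,\dots\}$. (i) Let $m\in\{2,3\}$ and $(c,d)\in S(m)$, where $$S(3)=\{(1,1),(1,2),(2,1),(2,2),(2,4)\}\quad\text{and}\quad S(2)=S(3)\cup\{(2,3),(2,6)\}.$$ Then any $n\in\mathbb{N}$ can be written as $x^2+y^2+z^2+w^2$ with $x,y,z,w\in\mathbb{Z}$ such that $x+y+cz=dt^m$ for some $t\in\mathbb{Z}$. (ii) If any odd integer $n>2719$ can be represented by $x^2+y^2+10z^2$ with $x,y,z\in\mathbb{Z}$, then each $n\in\mathbb{N}$ can be written as $x^2+y^2+z^2+w^2$ with $x,y,z,w\in\mathbb{Z}$ and $x+3y$ the square of an integer. (iii) If any integer $n\ge 1190$ not divisible by $16$ can be written as $x^2+10y^2+(2z^2+5^3r^4)/7$ with $r\in\{0,1,2,3\}$ and $x,y,z\in\mathbb{Z}$, then any $n\in\mathbb{N}$ can be written as $x^2+y^2+z^2+w^2$ with $x,y,z,w\in\mathbb{Z}$ and $x+3y+5z$ the square of an integer. -/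

import Mathlib

/-- The sets `S(2)` and `S(3)` of admissible pairs `(c, d)`; for all other `m` the set is
empty (only `m = 2` and `m = 3` are used). -/
def admissiblePairs : ℕ → Set (ℤ × ℤ)
  | 2 => {(1, 1), (1, 2), (2, 1), (2, 2), (2, 4)} ∪ {(2, 3), (2, 6)}
  | 3 => {(1, 1), (1, 2), (2, 1), (2, 2), (2, 4)}
  | _ => ∅

/-! Everything rests on the three-square theorem, obtained from the reduction of ternary forms
(`isSumThreeSq_of_det_eq_one`) and Dirichlet's theorem on primes. For (i), Euler's four-square
identity with multiplier 3 = 1+1+1 or 6 = 1+1+4 writes (2+c²)n as (x+y+cz)² plus three squares.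
After reordering and sign changes it can be inverted, so it suffices that (2+c²)n − s² is a sum of
three squares for s = d·t^m. Outside the excluded class 4^k(8j+7) take t = 0; inside it t = 1 or 2
works. For (ii), x+3y = 0 means (x,y) = (3c,−c), contributing 10c²: the hypothesis settles large odd
n, and the three-square theorem settles even n with x+3y equal to 0 or 4. For (iii), a linear
substitution turns the hypothesis into a representation with x+3y+5z = (5r)². Small n are computed,
and scaling the variables disposes of multiples of 16. -/

/-- The integer `n` is a sum of three integer squares. -/
def IsSumThreeSq (n : ℤ) : Prop := ∃ x y z : ℤ, n = x ^ 2 + y ^ 2 + z ^ 2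

/-! ### Reduction of unimodular ternary forms -/

theorem exists_shift_abs_le (a f : ℤ) (ha : 0 < a) : ∃ t : ℤ, |2 * (f + t * a)| ≤ a := by
  refine ⟨-((2 * f + a) / (2 * a)), ?_⟩
  have h1 := Int.mul_ediv_add_emod (2 * f + a) (2 * a)
  have h2 := Int.emod_nonneg (2 * f + a) (by omega : 2 * a ≠ 0)
  have h3 := Int.emod_lt_of_pos (2 * f + a) (by omega : 0 < 2 * a)
  rw [abs_le]
  constructor <;> linarith

theorem eq_one_of_sq_le {a g : ℤ} (ha : 0 < a) (hg : 0 < g) (h1 : 3 * g ^ 2 ≤ 4 * a)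
    (h2 : 3 * a ^ 2 ≤ 4 * g) : a = 1 ∧ g = 1 := by
  rcases le_total a g with h | h
  · have : g < 2 := by nlinarith
    omega
  · have : a < 2 := by nlinarith
    omega

/-- Every value of a positive definite ternary integral form of determinant one is a sum of three
squares. Here `g` is the second leading minor. -/
theorem isSumThreeSq_of_det_eq_one (a b c d e f g : ℤ) (ha : 0 < a) (hg : 0 < g)
    (hgd : a * b - f ^ 2 = g)
    (hdet : a * b * c + 2 * d * e * f - a * d ^ 2 - b * e ^ 2 - c * f ^ 2 = 1) (x y z : ℤ) :
    IsSumThreeSq (a * x ^ 2 + b * y ^ 2 + c * z ^ 2 + 2 * d * (y * z) + 2 * e * (x * z)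
      + 2 * f * (x * y)) := by
  -- Lexicographic descent on the leading coefficient `a`, then on the minor `g`.
  obtain ⟨A, hA⟩ : ∃ A : ℕ, A = a.toNat := ⟨_, rfl⟩
  induction A using Nat.strong_induction_on generalizing a b c d e f g x y z with
  | _ A ihA =>
  obtain ⟨G, hG⟩ : ∃ G : ℕ, G = g.toNat := ⟨_, rfl⟩
  induction G using Nat.strong_induction_on generalizing b c d e f g x y z with
  | _ G ihG =>
  -- make `f` small
  wlog hf : |2 * f| ≤ a generalizing b c d e f x y z with H
  · obtain ⟨t, ht⟩ := exists_shift_abs_le a f ha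
    have := H (b + 2 * f * t + a * t ^ 2) c (d + e * t) e (f + t * a) (by rw [← hgd]; ring)
      (by rw [← hdet]; ring) (x - t * y) y z ht
    convert this using 1
    ring
  -- make `e` small
  wlog he : |2 * e| ≤ a generalizing c d e x y z with H
  · obtain ⟨t, ht⟩ := exists_shift_abs_le a e ha
    have := H (c + 2 * e * t + a * t ^ 2) (d + f * t) (e + t * a)
      (by rw [← hdet]; ring) (x - t * z) y z ht
    convert this using 1
    ring
  by_cases hba : b < a
  · have hb : 0 < b := by nlinarith [sq_nonneg f]
    have := ihA b.toNat (by omega) b a c e d f g hb hg (by rw [← hgd]; ring)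
      (by rw [← hdet]; ring) y x z rfl
    convert this using 1
    ring
  -- Up to sign `a * d - e * f` is an entry of the adjugate; the substitution y ↦ y − tz shifts it
  -- by multiples of `g`.
  obtain ⟨t, ht⟩ := exists_shift_abs_le g (a * d - e * f) hg
  set c' := c + 2 * d * t + b * t ^ 2 with hc'
  set d' := d + b * t with hd'
  set e' := e + f * t with he'
  have hdet' : a * b * c' + 2 * d' * e' * f - a * d' ^ 2 - b * e' ^ 2 - c' * f ^ 2 = 1 := by
    rw [← hdet, hc', hd', he']; ring
  have hh : a * d' - e' * f = a * d - e * f + t * g := by rw [← hgd, hd', he']; ring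
  rw [← hh] at ht
  -- A 2×2 minor of the adjugate equals `a` times the determinant, which is 1.
  have hk : g * (a * c' - e' ^ 2) = a + (a * d' - e' * f) ^ 2 := by
    rw [← hgd]; linear_combination a * hdet'
  have hkpos : 0 < a * c' - e' ^ 2 := by
    by_contra hneg
    nlinarith [sq_nonneg (a * d' - e' * f)]
  by_cases hkg : a * c' - e' ^ 2 < g
  · have := ihG (a * c' - e' ^ 2).toNat (by omega) c' b d' f e' (a * c' - e' ^ 2) hkpos
      (by ring) (by rw [← hdet']; ring) x z (y - t * z) rfl
    convert this using 1
    rw [hc', hd', he']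
    ring
  have hab : a ≤ b := not_lt.1 hba
  have hgk : g ≤ a * c' - e' ^ 2 := not_lt.1 hkg
  -- No descent is possible: g² ≤ a + g²/4, and below a² ≤ g + a²/4, which force a = g = 1.
  have h4 : 3 * g ^ 2 ≤ 4 * a := by
    have h1 := sq_le_sq' (abs_le.1 ht).1 (abs_le.1 ht).2
    have h2 := mul_le_mul_of_nonneg_left hgk hg.le
    linarith
  have h5 : 3 * a ^ 2 ≤ 4 * g := by
    have h1 := sq_le_sq' (abs_le.1 hf).1 (abs_le.1 hf).2
    have h2 := mul_le_mul_of_nonneg_left hab ha.le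
    linarith
  obtain ⟨ha1, hg1⟩ := eq_one_of_sq_le ha hg h4 h5
  subst ha1 hg1
  have hf0 : f = 0 := by have := abs_le.1 hf; omega
  have he0 : e = 0 := by have := abs_le.1 he; omega
  subst hf0 he0
  have hb1 : b = 1 := by linarith
  subst hb1
  refine ⟨x, y + d * z, z, ?_⟩
  linear_combination z ^ 2 * hdet

/-! ### The three-square theorem -/

/-- If `-d` is a square modulo `d * n - 1`, then `n` is a sum of three squares. -/
theorem isSumThreeSq_of_dvd (n d x : ℤ) (hd : 0 < d) (hn : 0 < d * n - 1)
    (h : d * n - 1 ∣ x ^ 2 + d) : IsSumThreeSq n := by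
  obtain ⟨k, hk⟩ := h
  -- The matrix ((dn−1, x, 0), (x, k, 1), (0, 1, n)) has second minor d and determinant nd − (dn−1)
  -- = 1; its form takes the value n at (0,0,1).
  have := isSumThreeSq_of_det_eq_one (d * n - 1) k n 1 0 x d hn hd (by linarith)
    (by linear_combination (-n) * hk) 0 0 1
  simpa using this

theorem exists_dvd_sq_add_of_jacobiSym {p : ℕ} (hp : p.Prime) {b : ℤ}
    (h : jacobiSym (-b) p = 1) : ∃ x : ℤ, (p : ℤ) ∣ x ^ 2 + b := by
  have := Fact.mk hp
  obtain ⟨y, hy⟩ := ZMod.isSquare_of_jacobiSym_eq_one h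
  refine ⟨y.valMinAbs, ?_⟩
  rw [← ZMod.intCast_zmod_eq_zero_iff_dvd]
  push_cast at hy ⊢
  linear_combination -hy

theorem jacobiSym_eq_of_mul_eq {p b n k : ℕ} (h : k * p + 1 = b * n) :
    jacobiSym (k * p) b = jacobiSym (-1) b := by
  apply jacobiSym.mod_left'
  have : (k * p : ℤ) = -1 + b * n := by
    zify at h
    linarith
  rw [this, Int.add_mul_emod_self_left]

/-- Dirichlet gives a prime p = dn − 1 with d = 4v+1 and p ≡ 1 mod 4. By reciprocity (−d/p) = (p/d)
= (−1/d) = 1. -/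
theorem isSumThreeSq_of_two_mod_four (n : ℕ) (hn : n % 4 = 2) : IsSumThreeSq n := by
  have hcop : (n - 1).Coprime (4 * n) := by
    refine Nat.Coprime.mul_right ?_ ?_
    · exact Nat.Coprime.pow_right 2 (Nat.coprime_two_right.2 (Nat.odd_iff.2 (by omega)))
    · exact (Nat.coprime_self_sub_left (by omega)).2 (Nat.coprime_one_left n)
  obtain ⟨p, hpn, hp, hpm⟩ := Nat.forall_exists_prime_gt_and_modEq n (by omega) hcop
  obtain ⟨v, hv⟩ := (Nat.modEq_iff_dvd' (by omega)).1 hpm.symm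
  have hpv : 1 * p + 1 = (4 * v + 1) * n := by
    have : p = n - 1 + 4 * n * v := by omega
    rw [this]
    zify [show 1 ≤ n by omega]
    ring
  have hp4 : p % 4 = 1 := by
    have : p = n - 1 + 4 * (n * v) := by rw [← mul_assoc]; omega
    omega
  have hb : Odd (4 * v + 1) := ⟨2 * v, by ring⟩
  have hJ : jacobiSym (-((4 * v + 1 : ℕ) : ℤ)) p = 1 := by
    rw [neg_eq_neg_one_mul, jacobiSym.mul_left, jacobiSym.at_neg_one (Nat.odd_iff.2 (by omega)),
      ZMod.χ₄_nat_one_mod_four hp4, jacobiSym.quadratic_reciprocity_one_mod_four' hb hp4]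
    have := jacobiSym_eq_of_mul_eq hpv
    rw [jacobiSym.at_neg_one hb, ZMod.χ₄_nat_one_mod_four (by omega)] at this
    simpa using this
  obtain ⟨x, hx⟩ := exists_dvd_sq_add_of_jacobiSym hp hJ
  have hpe : ((4 * v + 1 : ℕ) : ℤ) * n - 1 = p := by
    zify at hpv ⊢
    linarith
  exact isSumThreeSq_of_dvd n (4 * v + 1 : ℕ) x (by positivity)
    (by rw [hpe]; exact_mod_cast hp.pos) (by rwa [hpe])

/-- Here Dirichlet gives 2p = dn − 1 with d = 8v+c. Since (2p/d) = (−1/d), the value of (2/d) yields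
(p/d) = 1, and reciprocity gives (−d/p) = 1. -/
theorem isSumThreeSq_of_odd (n c r : ℕ) (hcn : c * n = 2 * r + 1) (hc8 : c < 8)
    (hr : r.Coprime n)
    (hcr : c = 1 ∧ r % 4 = 1 ∨ c = 3 ∧ r % 2 = 1) : IsSumThreeSq n := by
  have hn : Odd n := by
    have : Odd (c * n) := ⟨r, hcn⟩
    exact (Nat.odd_mul.1 this).2
  have hcop : r.Coprime (4 * n) :=
    Nat.Coprime.mul_right (Nat.Coprime.pow_right 2
      (Nat.coprime_two_right.2 (Nat.odd_iff.2 (by omega)))) hr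
  have hn0 : 0 < n := hn.pos
  obtain ⟨p, hpr, hp, hpm⟩ := Nat.forall_exists_prime_gt_and_modEq r (by omega) hcop
  obtain ⟨v, hv⟩ := (Nat.modEq_iff_dvd' (by omega)).1 hpm.symm
  have hpv' : p = r + 4 * n * v := by omega
  have hpv : 2 * p + 1 = (8 * v + c) * n := by
    rw [hpv']
    linear_combination -hcn
  have hp4 : p % 4 = r % 4 := by
    rw [mul_assoc] at hpv'
    omega
  have hb : Odd (8 * v + c) := Nat.odd_iff.2 (by omega)
  have hpo : Odd p := Nat.odd_iff.2 (by omega)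
  have h2 := jacobiSym_eq_of_mul_eq hpv
  rw [jacobiSym.at_neg_one hb, jacobiSym.mul_left, Nat.cast_two, jacobiSym.at_two hb,
    ZMod.χ₄_nat_eq_if_mod_four, ZMod.χ₈_nat_eq_if_mod_eight] at h2
  have hJ : jacobiSym (-((8 * v + c : ℕ) : ℤ)) p = 1 := by
    rw [neg_eq_neg_one_mul, jacobiSym.mul_left, jacobiSym.at_neg_one hpo]
    rcases hcr with ⟨rfl, hr4⟩ | ⟨rfl, hr2⟩
    · rw [ZMod.χ₄_nat_one_mod_four (by omega),
        jacobiSym.quadratic_reciprocity_one_mod_four' hb (by omega)]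
      simpa [show (8 * v + 1) % 2 = 1 by omega, show (8 * v + 1) % 4 = 1 by omega,
        show (8 * v + 1) % 8 = 1 by omega] using h2
    · have hJp : jacobiSym p (8 * v + 3) = 1 := by
        simpa [show (8 * v + 3) % 2 = 1 by omega, show (8 * v + 3) % 4 = 3 by omega,
          show (8 * v + 3) % 8 = 3 by omega] using h2
      rcases Nat.odd_mod_four_iff.1 (Nat.odd_iff.1 hpo) with h4 | h4
      · rw [ZMod.χ₄_nat_one_mod_four h4,
          jacobiSym.quadratic_reciprocity_one_mod_four' hb h4, hJp, one_mul]
      · rw [ZMod.χ₄_nat_three_mod_four h4,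
          jacobiSym.quadratic_reciprocity_three_mod_four (by omega) h4, hJp]
        norm_num
  obtain ⟨x, hx⟩ := exists_dvd_sq_add_of_jacobiSym hp hJ
  have hpe : ((8 * v + c : ℕ) : ℤ) * n - 1 = 2 * p := by
    zify at hpv ⊢
    linarith
  -- Of x and x+p the odd one also makes y² + d even, so 2p divides it.
  obtain ⟨y, hy, hy2⟩ : ∃ y : ℤ, (p : ℤ) ∣ y ^ 2 + (8 * v + c : ℕ) ∧
      (2 : ℤ) ∣ y ^ 2 + (8 * v + c : ℕ) := by
    have hb' : Odd ((8 * v + c : ℕ) : ℤ) := by exact_mod_cast hb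
    rcases Int.even_or_odd x with h | h
    · refine ⟨x + p, ?_, ?_⟩
      · have := dvd_add hx (dvd_mul_right (p : ℤ) (2 * x + p))
        rwa [show x ^ 2 + ((8 * v + c : ℕ) : ℤ) + p * (2 * x + p)
          = (x + p) ^ 2 + ((8 * v + c : ℕ) : ℤ) by ring] at this
      · have : Odd (x + p) := h.add_odd (by exact_mod_cast hpo)
        exact ((this.pow).add_odd hb').two_dvd
    · exact ⟨x, hx, ((h.pow).add_odd hb').two_dvd⟩
  refine isSumThreeSq_of_dvd n (8 * v + c : ℕ) y (by exact_mod_cast hb.pos)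
    (by rw [hpe]; have := hp.pos; positivity) ?_
  rw [hpe]
  refine IsCoprime.mul_dvd ?_ hy2 hy
  rw [← Nat.cast_two, Nat.isCoprime_iff_coprime]
  exact Nat.coprime_two_left.2 hpo

/-- The three-square theorem for integers not divisible by four. -/
theorem isSumThreeSq_of_mod_eight (n : ℤ) (hn : 0 ≤ n) (h4 : n % 4 ≠ 0) (h8 : n % 8 ≠ 7) :
    IsSumThreeSq n := by
  lift n to ℕ using hn
  have hcop : ∀ c r : ℕ, c * n = 2 * r + 1 → r.Coprime n := by
    intro c r h
    refine Nat.isCoprime_iff_coprime.1 ⟨-2, c, ?_⟩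
    zify at h
    linarith
  rcases (by omega : n % 4 = 2 ∨ n % 8 = 3 ∨ n % 8 = 1 ∨ n % 8 = 5) with h | h | h | h
  · exact isSumThreeSq_of_two_mod_four n h
  · exact isSumThreeSq_of_odd n 1 ((n - 1) / 2) (by omega) (by omega) (hcop 1 _ (by omega))
      (by omega)
  · exact isSumThreeSq_of_odd n 3 ((3 * n - 1) / 2) (by omega) (by omega) (hcop 3 _ (by omega))
      (by omega)
  · exact isSumThreeSq_of_odd n 3 ((3 * n - 1) / 2) (by omega) (by omega) (hcop 3 _ (by omega))
      (by omega)

theorem IsSumThreeSq.mul_sq {n : ℤ} (h : IsSumThreeSq n) (k : ℤ) : IsSumThreeSq (k ^ 2 * n) := by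
  obtain ⟨x, y, z, rfl⟩ := h
  exact ⟨k * x, k * y, k * z, by ring⟩

/-! ### Small cases by bit masks -/

/-- The bitwise disjunction of `f 0, …, f (k - 1)`. -/
def orMask (f : ℕ → ℕ) : ℕ → ℕ
  | 0 => 0
  | k + 1 => orMask f k ||| f k

theorem exists_testBit_of_orMask {f : ℕ → ℕ} {k n : ℕ} (h : (orMask f k).testBit n = true) :
    ∃ i, (f i).testBit n = true := by
  induction k with
  | zero => simp [orMask] at h
  | succ k ih =>
    rw [orMask, Nat.testBit_or, Bool.or_eq_true] at h
    exact h.elim ih fun h => ⟨k, h⟩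

theorem testBit_of_mod_two_pow {M N n : ℕ} (h : M % 2 ^ N = 2 ^ N - 1) (hn : n < N) :
    M.testBit n = true := by
  have := congrArg (fun x => x.testBit n) h
  simpa [Nat.testBit_mod_two_pow, Nat.testBit_two_pow_sub_one, hn] using this

/-- The bits of `squareShifts m k` mark the sums of a marked number of `m` and a square. -/
def squareShifts (m k : ℕ) : ℕ := orMask (fun i => m <<< (i ^ 2)) k

theorem exists_testBit_of_squareShifts {m k n : ℕ} (h : (squareShifts m k).testBit n = true) :
    ∃ i n' : ℕ, n = n' + i ^ 2 ∧ m.testBit n' = true := by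
  obtain ⟨i, hi⟩ := exists_testBit_of_orMask h
  rw [Nat.testBit_shiftLeft, Bool.and_eq_true, decide_eq_true_iff] at hi
  exact ⟨i, n - i ^ 2, by omega, hi.2⟩

theorem eq_of_testBit_one_shiftLeft {a n : ℕ} (h : (1 <<< a).testBit n = true) : n = a := by
  rw [Nat.one_shiftLeft, Nat.testBit_two_pow] at h
  exact (decide_eq_true_iff.1 h).symm

/-- Marks the values `x ^ 2 + y ^ 2` with `x + 3 * y` a square, for small `x` and `y`. -/
def oneThreeMask : ℕ :=
  orMask (fun t => orMask (fun i =>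
    1 <<< (((t : ℤ) ^ 2 - 3 * ((i : ℤ) - 10)) ^ 2 + ((i : ℤ) - 10) ^ 2).toNat) 21) 5

/-- Marks the values `x ^ 2 + y ^ 2 + z ^ 2` with `x + 3 * y + 5 * z` a square, for small `x`, `y`
and `z`. -/
def oneThreeFiveMask : ℕ :=
  orMask (fun t => orMask (fun i => orMask (fun j =>
    1 <<< (((t : ℤ) ^ 2 - 3 * ((i : ℤ) - 20) - 5 * ((j : ℤ) - 20)) ^ 2
      + ((i : ℤ) - 20) ^ 2 + ((j : ℤ) - 20) ^ 2).toNat) 41) 41) 5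

theorem exists_of_testBit_oneThreeMask {n : ℕ} (h : oneThreeMask.testBit n = true) :
    ∃ x y : ℤ, (n : ℤ) = x ^ 2 + y ^ 2 ∧ IsSquare (x + 3 * y) := by
  obtain ⟨t, ht⟩ := exists_testBit_of_orMask h
  obtain ⟨i, hi⟩ := exists_testBit_of_orMask ht
  have := eq_of_testBit_one_shiftLeft hi
  refine ⟨(t : ℤ) ^ 2 - 3 * ((i : ℤ) - 10), (i : ℤ) - 10, ?_, (t : ℤ), by ring⟩
  rw [this, Int.toNat_of_nonneg (by positivity)]

theorem exists_of_testBit_oneThreeFiveMask {n : ℕ} (h : oneThreeFiveMask.testBit n = true) :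
    ∃ x y z : ℤ, (n : ℤ) = x ^ 2 + y ^ 2 + z ^ 2 ∧ IsSquare (x + 3 * y + 5 * z) := by
  obtain ⟨t, ht⟩ := exists_testBit_of_orMask h
  obtain ⟨i, hi⟩ := exists_testBit_of_orMask ht
  obtain ⟨j, hj⟩ := exists_testBit_of_orMask hi
  have := eq_of_testBit_one_shiftLeft hj
  refine ⟨(t : ℤ) ^ 2 - 3 * ((i : ℤ) - 20) - 5 * ((j : ℤ) - 20), (i : ℤ) - 20, (j : ℤ) - 20, ?_,
    (t : ℤ), by ring⟩
  rw [this, Int.toNat_of_nonneg (by positivity)]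

/-- Two passes add the two free squares; 52² < 2720 ≤ 53². -/
theorem squareShifts_oneThreeMask :
    squareShifts (squareShifts oneThreeMask 53) 53 % 2 ^ 2720 = 2 ^ 2720 - 1 := by
  decide +kernel

/-- Only w is free here; 34² < 1190 ≤ 35². -/
theorem squareShifts_oneThreeFiveMask :
    squareShifts oneThreeFiveMask 35 % 2 ^ 1190 = 2 ^ 1190 - 1 := by
  decide +kernel

theorem exists_oneThree_of_lt (n : ℕ) (hn : n < 2720) : ∃ x y z w : ℤ,
    (n : ℤ) = x ^ 2 + y ^ 2 + z ^ 2 + w ^ 2 ∧ IsSquare (x + 3 * y) := by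
  obtain ⟨i, k, rfl, hk⟩ := exists_testBit_of_squareShifts
    (testBit_of_mod_two_pow squareShifts_oneThreeMask hn)
  obtain ⟨j, l, rfl, hl⟩ := exists_testBit_of_squareShifts hk
  obtain ⟨x, y, h, hs⟩ := exists_of_testBit_oneThreeMask hl
  exact ⟨x, y, j, i, by push_cast; rw [h], hs⟩

theorem exists_oneThreeFive_of_lt (n : ℕ) (hn : n < 1190) : ∃ x y z w : ℤ,
    (n : ℤ) = x ^ 2 + y ^ 2 + z ^ 2 + w ^ 2 ∧ IsSquare (x + 3 * y + 5 * z) := by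
  obtain ⟨i, k, rfl, hk⟩ := exists_testBit_of_squareShifts
    (testBit_of_mod_two_pow squareShifts_oneThreeFiveMask hn)
  obtain ⟨x, y, z, h, hs⟩ := exists_of_testBit_oneThreeFiveMask hk
  exact ⟨x, y, z, i, by push_cast; rw [h], hs⟩

/-! ### Inverting Euler's identity -/

theorem exists_sq_eq_sq_of_not_three_dvd (a r : ℤ) (ha : a % 3 ≠ 0) (hr : r % 3 ≠ 0) :
    ∃ b : ℤ, b ^ 2 = a ^ 2 ∧ (b - r) % 3 = 0 := by
  by_cases h : (a - r) % 3 = 0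
  · exact ⟨a, rfl, h⟩
  · refine ⟨-a, by ring, ?_⟩
    rcases (by omega : a % 3 = 1 ∨ a % 3 = 2) with h | h <;> omega

theorem sq_emod_three (a : ℤ) : a % 3 = 0 ∧ a ^ 2 % 3 = 0 ∨ a % 3 ≠ 0 ∧ a ^ 2 % 3 = 1 := by
  rcases (by omega : a % 3 = 0 ∨ a % 3 = 1 ∨ a % 3 = 2) with h | h | h <;>
    simp [pow_two, Int.mul_emod, h]

/-- Inverts 3n = (x+y+z)² + (x−y+w)² + (y−z+w)² + (z−x+w)². Squares mod 3 determine how many of X,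
Y, Z are divisible by 3, so order and signs can be arranged to give the needed congruences. -/
theorem exists_sum_eq_of_isSumThreeSq {n s : ℤ} (h : IsSumThreeSq (3 * n - s ^ 2)) :
    ∃ x y z w : ℤ, n = x ^ 2 + y ^ 2 + z ^ 2 + w ^ 2 ∧ x + y + z = s := by
  suffices H : ∃ X Y Z : ℤ, 3 * n - s ^ 2 = X ^ 2 + Y ^ 2 + Z ^ 2 ∧ (X - Z + s) % 3 = 0 ∧
      (Y - X + s) % 3 = 0 by
    obtain ⟨X, Y, Z, hs, h1, h2⟩ := H
    obtain ⟨z, hz⟩ : (3 : ℤ) ∣ s + Z - Y := by omega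
    obtain ⟨y, hy⟩ : (3 : ℤ) ∣ s + Y - X := by omega
    obtain ⟨w, hw⟩ : (3 : ℤ) ∣ X + Y + Z := by omega
    refine ⟨s - y - z, y, z, w, ?_, by ring⟩
    obtain rfl : Z = 3 * z + Y - s := by linarith
    obtain rfl : X = s + Y - 3 * y := by linarith
    obtain rfl : Y = w + y - z := by linarith
    linarith
  obtain ⟨X, Y, Z, hs⟩ := h
  by_cases hs3 : s % 3 = 0
  · by_cases hX : X % 3 = 0
    · have := sq_emod_three X
      have := sq_emod_three Y
      have := sq_emod_three Z
      have := sq_emod_three s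
      exact ⟨X, Y, Z, hs, by omega, by omega⟩
    · have hYZ : Y % 3 ≠ 0 ∧ Z % 3 ≠ 0 := by
        have := sq_emod_three X
        have := sq_emod_three Y
        have := sq_emod_three Z
        have := sq_emod_three s
        omega
      obtain ⟨Y', hY, hY'⟩ := exists_sq_eq_sq_of_not_three_dvd Y X hYZ.1 hX
      obtain ⟨Z', hZ, hZ'⟩ := exists_sq_eq_sq_of_not_three_dvd Z X hYZ.2 hX
      exact ⟨X, Y', Z', by rw [hY, hZ, hs], by omega, by omega⟩
  · have key : ∀ A B C : ℤ, 3 * n - s ^ 2 = A ^ 2 + B ^ 2 + C ^ 2 → A % 3 ≠ 0 → B % 3 ≠ 0 →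
        C % 3 = 0 → ∃ X Y Z : ℤ, 3 * n - s ^ 2 = X ^ 2 + Y ^ 2 + Z ^ 2 ∧ (X - Z + s) % 3 = 0 ∧
        (Y - X + s) % 3 = 0 := by
      intro A B C h hA hB hC
      obtain ⟨A', hA1, hA2⟩ := exists_sq_eq_sq_of_not_three_dvd A (-s) hA (by omega)
      obtain ⟨B', hB1, hB2⟩ := exists_sq_eq_sq_of_not_three_dvd B s hB (by omega)
      exact ⟨A', B', C, by rw [hA1, hB1, h], by omega, by omega⟩
    have hcase : (X % 3 ≠ 0 ∧ Y % 3 ≠ 0 ∧ Z % 3 = 0) ∨ (X % 3 ≠ 0 ∧ Y % 3 = 0 ∧ Z % 3 ≠ 0) ∨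
        (X % 3 = 0 ∧ Y % 3 ≠ 0 ∧ Z % 3 ≠ 0) := by
      have := sq_emod_three X
      have := sq_emod_three Y
      have := sq_emod_three Z
      have := sq_emod_three s
      omega
    rcases hcase with ⟨h1, h2, h3⟩ | ⟨h1, h2, h3⟩ | ⟨h1, h2, h3⟩
    · exact key X Y Z hs h1 h2 h3
    · exact key X Z Y (by linarith) h1 h3 h2
    · exact key Y Z X (by linarith) h2 h3 h1

/-- Inverts 6n = (x+y+2z)² + (2x−z+w)² + (2y−z−w)² + (x−y−2w)². Two of the three roots share a
parity, which fixes their order mod 2; signs handle mod 3. -/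
theorem exists_sum_two_mul_eq_of_isSumThreeSq {n s : ℤ} (h : IsSumThreeSq (6 * n - s ^ 2)) :
    ∃ x y z w : ℤ, n = x ^ 2 + y ^ 2 + z ^ 2 + w ^ 2 ∧ x + y + 2 * z = s := by
  obtain ⟨X, Y, Z, hs, hpar⟩ : ∃ X Y Z : ℤ, 6 * n - s ^ 2 = X ^ 2 + Y ^ 2 + Z ^ 2 ∧
      X % 2 = Y % 2 := by
    obtain ⟨X, Y, Z, hs⟩ := h
    rcases (by omega : X % 2 = Y % 2 ∨ X % 2 = Z % 2 ∨ Y % 2 = Z % 2) with h | h | h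
    · exact ⟨X, Y, Z, hs, h⟩
    · exact ⟨X, Z, Y, by linarith, h⟩
    · exact ⟨Y, Z, X, by linarith, h⟩
  obtain ⟨X, Y, Z, hs, hpar, h1, h2⟩ : ∃ X Y Z : ℤ, 6 * n - s ^ 2 = X ^ 2 + Y ^ 2 + Z ^ 2 ∧
      X % 2 = Y % 2 ∧ (X + Y - Z) % 3 = 0 ∧ (X - Y + s) % 3 = 0 := by
    have hpar2 : ∀ a b : ℤ, b ^ 2 = a ^ 2 → b % 2 = a % 2 := by
      intro a b hab
      rcases sq_eq_sq_iff_eq_or_eq_neg.1 hab with rfl | rfl <;> omega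
    have hX := sq_emod_three X
    have hY := sq_emod_three Y
    have hZ := sq_emod_three Z
    have hS := sq_emod_three s
    by_cases hs3 : s % 3 = 0
    · by_cases hX0 : X % 3 = 0
      · exact ⟨X, Y, Z, hs, hpar, by omega, by omega⟩
      · obtain ⟨Y', hY1, hY2⟩ := exists_sq_eq_sq_of_not_three_dvd Y X (by omega) (by omega)
        obtain ⟨Z', hZ1, hZ2⟩ := exists_sq_eq_sq_of_not_three_dvd Z (-X) (by omega) (by omega)
        exact ⟨X, Y', Z', by rw [hY1, hZ1, hs], by rw [hpar2 _ _ hY1, hpar], by omega, by omega⟩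
    · rcases (by omega : (X % 3 ≠ 0 ∧ Y % 3 ≠ 0 ∧ Z % 3 = 0) ∨
        (X % 3 ≠ 0 ∧ Y % 3 = 0 ∧ Z % 3 ≠ 0) ∨ (X % 3 = 0 ∧ Y % 3 ≠ 0 ∧ Z % 3 ≠ 0))
        with ⟨c1, c2, c3⟩ | ⟨c1, c2, c3⟩ | ⟨c1, c2, c3⟩
      · obtain ⟨X', hX1, hX2⟩ := exists_sq_eq_sq_of_not_three_dvd X s c1 (by omega)
        obtain ⟨Y', hY1, hY2⟩ := exists_sq_eq_sq_of_not_three_dvd Y (-s) c2 (by omega)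
        exact ⟨X', Y', Z, by rw [hX1, hY1, hs], by rw [hpar2 _ _ hX1, hpar2 _ _ hY1, hpar],
          by omega, by omega⟩
      · obtain ⟨X', hX1, hX2⟩ := exists_sq_eq_sq_of_not_three_dvd X (-s) c1 (by omega)
        obtain ⟨Z', hZ1, hZ2⟩ := exists_sq_eq_sq_of_not_three_dvd Z (-s) c3 (by omega)
        exact ⟨X', Y, Z', by rw [hX1, hZ1, hs], by rw [hpar2 _ _ hX1, hpar], by omega, by omega⟩
      · obtain ⟨Y', hY1, hY2⟩ := exists_sq_eq_sq_of_not_three_dvd Y s c2 (by omega)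
        obtain ⟨Z', hZ1, hZ2⟩ := exists_sq_eq_sq_of_not_three_dvd Z s c3 (by omega)
        exact ⟨X, Y', Z', by rw [hY1, hZ1, hs], by rw [hpar2 _ _ hY1, hpar], by omega, by omega⟩
  have hZs : (Z + s) % 2 = 0 := by
    have e : Even (X ^ 2 + Y ^ 2 + Z ^ 2 + s ^ 2) := ⟨3 * n, by linarith⟩
    have hXY : Even (X + Y) := Int.even_iff.2 (by omega)
    rw [← Int.even_iff]
    simp only [Int.even_add, Int.even_pow, ne_eq, OfNat.ofNat_ne_zero, not_false_eq_true,
      and_true] at e hXY ⊢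
    tauto
  obtain ⟨v, hv⟩ : (2 : ℤ) ∣ X - Y := by omega
  obtain ⟨w, hw⟩ : (3 : ℤ) ∣ Y + v + Z := by omega
  obtain ⟨z, hz⟩ : (3 : ℤ) ∣ s - v := by omega
  obtain ⟨x, hx⟩ : (2 : ℤ) ∣ s - 2 * z + (2 * w - Z) := by omega
  refine ⟨x, s - 2 * z - x, z, w, ?_, by ring⟩
  obtain rfl : X = 2 * v + Y := by linarith
  obtain rfl : Z = 3 * w - Y - v := by linarith
  obtain rfl : v = s - 3 * z := by linarith
  obtain rfl : Y = 2 * x - 2 * s + 5 * z + w := by linarith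
  linarith

/-! ### Part (i) -/

/-- The set of `n` that are sums of four squares `x ^ 2 + y ^ 2 + z ^ 2 + w ^ 2` with
`x + y + c * z = s`. -/
def sumFourSqWith (c s : ℤ) : Set ℤ :=
  {n | ∃ x y z w : ℤ, n = x ^ 2 + y ^ 2 + z ^ 2 + w ^ 2 ∧ x + y + c * z = s}

theorem isSumThreeSq_of_eq_four_pow_mul {n M : ℤ} (k : ℕ) (h : n = 4 ^ k * M) (hM : 0 ≤ M)
    (h4 : M % 4 ≠ 0) (h8 : M % 8 ≠ 7) : IsSumThreeSq n := by
  rw [h, show (4 : ℤ) = 2 ^ 2 by norm_num, ← pow_mul, mul_comm 2 k, pow_mul]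
  exact (isSumThreeSq_of_mod_eight M hM h4 h8).mul_sq _

theorem mem_sumFourSqWith_one {n s M : ℤ} (k : ℕ) (h : 3 * n - s ^ 2 = 4 ^ k * M) (hM : 0 ≤ M)
    (h4 : M % 4 ≠ 0) (h8 : M % 8 ≠ 7) : n ∈ sumFourSqWith 1 s := by
  obtain ⟨x, y, z, w, hn, hs⟩ :=
    exists_sum_eq_of_isSumThreeSq (isSumThreeSq_of_eq_four_pow_mul k h hM h4 h8)
  exact ⟨x, y, z, w, hn, by linarith⟩

theorem mem_sumFourSqWith_two {n s M : ℤ} (k : ℕ) (h : 6 * n - s ^ 2 = 4 ^ k * M) (hM : 0 ≤ M)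
    (h4 : M % 4 ≠ 0) (h8 : M % 8 ≠ 7) : n ∈ sumFourSqWith 2 s :=
  exists_sum_two_mul_eq_of_isSumThreeSq (isSumThreeSq_of_eq_four_pow_mul k h hM h4 h8)

/-- Induction along `n ↦ N * n`. -/
theorem forall_nat_of_not_dvd {P : ℕ → Prop} (N : ℕ) (hN : 1 < N) (h0 : P 0)
    (hmul : ∀ n, P n → P (N * n)) (h : ∀ n, ¬ N ∣ n → P n) (n : ℕ) : P n := by
  induction n using Nat.strong_induction_on with
  | _ n ih =>
  by_cases hd : N ∣ n
  · obtain ⟨k, rfl⟩ := hd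
    rcases Nat.eq_zero_or_pos k with rfl | hk
    · simpa using h0
    · exact hmul k (ih k (by nlinarith))
  · exact h n hd

/-- Scaling the variables by 2^m multiplies n by 4^m and t by 2. -/
theorem exists_mem_sumFourSqWith_of_not_dvd (c d : ℤ) (m : ℕ) (hm : 0 < m)
    (h : ∀ n : ℕ, ¬ 4 ^ m ∣ n → ∃ t : ℤ, (n : ℤ) ∈ sumFourSqWith c (d * t ^ m)) (n : ℕ) :
    ∃ t : ℤ, (n : ℤ) ∈ sumFourSqWith c (d * t ^ m) := by
  refine forall_nat_of_not_dvd (4 ^ m) (Nat.one_lt_pow hm.ne' (by norm_num))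
    ⟨0, 0, 0, 0, 0, by simp, by simp [hm.ne']⟩ ?_ h n
  rintro n ⟨t, x, y, z, w, hn, hs⟩
  refine ⟨2 * t, 2 ^ m * x, 2 ^ m * y, 2 ^ m * z, 2 ^ m * w, ?_, ?_⟩
  · have : ((4 ^ m : ℕ) : ℤ) = (2 ^ m) ^ 2 := by
      rw [← pow_mul, mul_comm, pow_mul]; norm_num
    rw [Nat.cast_mul, this, hn]
    ring
  · rw [mul_pow]
    linear_combination 2 ^ m * hs

/-- 3n = 4^k(8j+7) exactly when n = 4^k(8l+5), and 64 ∤ n leaves k ≤ 2. -/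
theorem mem_sumFourSqWith_one_or_eq (n : ℕ) (h : ¬ 64 ∣ n) : (n : ℤ) ∈ sumFourSqWith 1 0 ∨
    ∃ l : ℕ, n = 8 * l + 5 ∨ n = 4 * (8 * l + 5) ∨ n = 16 * (8 * l + 5) := by
  have key : ∀ k m : ℕ, n = 4 ^ k * m → m % 4 ≠ 0 → m % 8 ≠ 5 → (n : ℤ) ∈ sumFourSqWith 1 0 :=
    fun k m hn h4 h8 => mem_sumFourSqWith_one (M := 3 * m) k (by rw [hn]; push_cast; ring)
      (by positivity) (by omega) (by omega)
  rcases (by omega : n % 4 ≠ 0 ∨ n % 4 = 0 ∧ n / 4 % 4 ≠ 0 ∨ n % 16 = 0 ∧ n / 16 % 4 ≠ 0)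
    with h4 | h4 | h4
  · by_cases h8 : n % 8 = 5
    · exact .inr ⟨n / 8, by omega⟩
    · exact .inl (key 0 n (by simp) h4 h8)
  · by_cases h8 : n / 4 % 8 = 5
    · exact .inr ⟨n / 4 / 8, by omega⟩
    · exact .inl (key 1 (n / 4) (by omega) h4.2 h8)
  · by_cases h8 : n / 16 % 8 = 5
    · exact .inr ⟨n / 16 / 8, by omega⟩
    · exact .inl (key 2 (n / 16) (by omega) h4.2 h8)

theorem mem_sumFourSqWith_two_or_eq (n : ℕ) (h : ¬ 64 ∣ n) : (n : ℤ) ∈ sumFourSqWith 2 0 ∨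
    ∃ l : ℕ, n = 16 * l + 10 ∨ n = 4 * (16 * l + 10) ∨ n = 16 * (16 * l + 10) := by
  have key : ∀ k m : ℕ, n = 4 ^ k * m → m % 4 ≠ 0 → m % 16 ≠ 10 →
      (n : ℤ) ∈ sumFourSqWith 2 0 := by
    intro k m hn h4 h16
    rcases Nat.even_or_odd' m with ⟨m', rfl | rfl⟩
    · exact mem_sumFourSqWith_two (M := 3 * m') (k + 1) (by rw [hn]; push_cast; ring)
        (by positivity) (by omega) (by omega)
    · exact mem_sumFourSqWith_two (M := 6 * (2 * m' + 1)) k (by rw [hn]; push_cast; ring)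
        (by positivity) (by omega) (by omega)
  rcases (by omega : n % 4 ≠ 0 ∨ n % 4 = 0 ∧ n / 4 % 4 ≠ 0 ∨ n % 16 = 0 ∧ n / 16 % 4 ≠ 0)
    with h4 | h4 | h4
  · by_cases h8 : n % 16 = 10
    · exact .inr ⟨n / 16, by omega⟩
    · exact .inl (key 0 n (by simp) h4 h8)
  · by_cases h8 : n / 4 % 16 = 10
    · exact .inr ⟨n / 4 / 16, by omega⟩
    · exact .inl (key 1 (n / 4) (by omega) h4.2 h8)
  · by_cases h8 : n / 16 % 16 = 10
    · exact .inr ⟨n / 16 / 16, by omega⟩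
    · exact .inl (key 2 (n / 16) (by omega) h4.2 h8)

theorem exists_mem_sumFourSqWith_one (d : ℤ) (m : ℕ) (hm : m = 2 ∨ m = 3)
    (h5 : ∀ l : ℕ, ∃ t : ℤ, ((8 * l + 5 : ℕ) : ℤ) ∈ sumFourSqWith 1 (d * t ^ m))
    (h20 : ∀ l : ℕ, ∃ t : ℤ, ((4 * (8 * l + 5) : ℕ) : ℤ) ∈ sumFourSqWith 1 (d * t ^ m))
    (h80 : m = 3 → ∀ l : ℕ, ∃ t : ℤ,
      ((16 * (8 * l + 5) : ℕ) : ℤ) ∈ sumFourSqWith 1 (d * t ^ m)) (n : ℕ) :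
    ∃ t : ℤ, (n : ℤ) ∈ sumFourSqWith 1 (d * t ^ m) := by
  refine exists_mem_sumFourSqWith_of_not_dvd 1 d m (by omega) (fun n hn => ?_) n
  have h64 : ¬ 64 ∣ n := by rcases hm with rfl | rfl <;> omega
  rcases mem_sumFourSqWith_one_or_eq n h64 with h | ⟨l, rfl | rfl | rfl⟩
  · exact ⟨0, by rwa [zero_pow (by omega), mul_zero]⟩
  · exact h5 l
  · exact h20 l
  · rcases hm with rfl | rfl
    · exact absurd (dvd_mul_right _ _) hn
    · exact h80 rfl l

theorem exists_mem_sumFourSqWith_two (d : ℤ) (m : ℕ) (hm : m = 2 ∨ m = 3)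
    (h10 : ∀ l : ℕ, ∃ t : ℤ, ((16 * l + 10 : ℕ) : ℤ) ∈ sumFourSqWith 2 (d * t ^ m))
    (h40 : ∀ l : ℕ, ∃ t : ℤ, ((4 * (16 * l + 10) : ℕ) : ℤ) ∈ sumFourSqWith 2 (d * t ^ m))
    (h160 : m = 3 → ∀ l : ℕ, ∃ t : ℤ,
      ((16 * (16 * l + 10) : ℕ) : ℤ) ∈ sumFourSqWith 2 (d * t ^ m)) (n : ℕ) :
    ∃ t : ℤ, (n : ℤ) ∈ sumFourSqWith 2 (d * t ^ m) := by
  refine exists_mem_sumFourSqWith_of_not_dvd 2 d m (by omega) (fun n hn => ?_) n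
  have h64 : ¬ 64 ∣ n := by rcases hm with rfl | rfl <;> omega
  rcases mem_sumFourSqWith_two_or_eq n h64 with h | ⟨l, rfl | rfl | rfl⟩
  · exact ⟨0, by rwa [zero_pow (by omega), mul_zero]⟩
  · exact h10 l
  · exact h40 l
  · rcases hm with rfl | rfl
    · exact absurd (dvd_mul_right _ _) hn
    · exact h160 rfl l

theorem exists_mem_sumFourSqWith_one_one (m : ℕ) (hm : m = 2 ∨ m = 3) (n : ℕ) :
    ∃ t : ℤ, (n : ℤ) ∈ sumFourSqWith 1 (1 * t ^ m) := by
  refine exists_mem_sumFourSqWith_one 1 m hm (fun l => ⟨1, ?_⟩) (fun l => ⟨1, ?_⟩) ?_ n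
  · exact mem_sumFourSqWith_one (M := 24 * l + 14) 0 (by rw [one_pow]; push_cast; ring)
      (by omega) (by omega) (by omega)
  · exact mem_sumFourSqWith_one (M := 96 * l + 59) 0 (by rw [one_pow]; push_cast; ring)
      (by omega) (by omega) (by omega)
  · rintro rfl l
    exact ⟨2, mem_sumFourSqWith_one (M := 24 * l + 11) 2 (by push_cast; ring)
      (by omega) (by omega) (by omega)⟩

theorem exists_mem_sumFourSqWith_one_two (m : ℕ) (hm : m = 2 ∨ m = 3) (n : ℕ) :
    ∃ t : ℤ, (n : ℤ) ∈ sumFourSqWith 1 (2 * t ^ m) := by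
  refine exists_mem_sumFourSqWith_one 2 m hm (fun l => ⟨1, ?_⟩) (fun l => ⟨1, ?_⟩)
    (fun _ l => ⟨1, ?_⟩) n
  · exact mem_sumFourSqWith_one (M := 24 * l + 11) 0 (by rw [one_pow]; push_cast; ring)
      (by omega) (by omega) (by omega)
  · exact mem_sumFourSqWith_one (M := 24 * l + 14) 1 (by rw [one_pow]; push_cast; ring)
      (by omega) (by omega) (by omega)
  · exact mem_sumFourSqWith_one (M := 96 * l + 59) 1 (by rw [one_pow]; push_cast; ring)
      (by omega) (by omega) (by omega)

theorem exists_mem_sumFourSqWith_two_one (m : ℕ) (hm : m = 2 ∨ m = 3) (n : ℕ) :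
    ∃ t : ℤ, (n : ℤ) ∈ sumFourSqWith 2 (1 * t ^ m) := by
  refine exists_mem_sumFourSqWith_two 1 m hm (fun l => ⟨1, ?_⟩) (fun l => ⟨2, ?_⟩) ?_ n
  · exact mem_sumFourSqWith_two (M := 96 * l + 59) 0 (by rw [one_pow]; push_cast; ring)
      (by omega) (by omega) (by omega)
  -- Here t = 2 makes s = 4 or 8, so 6n − s² is 16(24l+14) or 16(24l+11).
  · rcases hm with rfl | rfl
    · exact mem_sumFourSqWith_two (M := 24 * l + 14) 2 (by push_cast; ring)
        (by omega) (by omega) (by omega)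
    · exact mem_sumFourSqWith_two (M := 24 * l + 11) 2 (by push_cast; ring)
        (by omega) (by omega) (by omega)
  · rintro rfl l
    exact ⟨2, mem_sumFourSqWith_two (M := 24 * l + 14) 3 (by push_cast; ring)
      (by omega) (by omega) (by omega)⟩

theorem exists_mem_sumFourSqWith_two_two (m : ℕ) (hm : m = 2 ∨ m = 3) (n : ℕ) :
    ∃ t : ℤ, (n : ℤ) ∈ sumFourSqWith 2 (2 * t ^ m) := by
  refine exists_mem_sumFourSqWith_two 2 m hm (fun l => ⟨1, ?_⟩) (fun l => ⟨1, ?_⟩) ?_ n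
  · exact mem_sumFourSqWith_two (M := 24 * l + 14) 1 (by rw [one_pow]; push_cast; ring)
      (by omega) (by omega) (by omega)
  · exact mem_sumFourSqWith_two (M := 96 * l + 59) 1 (by rw [one_pow]; push_cast; ring)
      (by omega) (by omega) (by omega)
  · rintro rfl l
    exact ⟨2, mem_sumFourSqWith_two (M := 24 * l + 11) 3 (by push_cast; ring)
      (by omega) (by omega) (by omega)⟩

theorem exists_mem_sumFourSqWith_two_four (m : ℕ) (hm : m = 2 ∨ m = 3) (n : ℕ) :
    ∃ t : ℤ, (n : ℤ) ∈ sumFourSqWith 2 (4 * t ^ m) := by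
  refine exists_mem_sumFourSqWith_two 4 m hm (fun l => ⟨1, ?_⟩) (fun l => ⟨1, ?_⟩)
    (fun _ l => ⟨1, ?_⟩) n
  · exact mem_sumFourSqWith_two (M := 24 * l + 11) 1 (by rw [one_pow]; push_cast; ring)
      (by omega) (by omega) (by omega)
  · exact mem_sumFourSqWith_two (M := 24 * l + 14) 2 (by rw [one_pow]; push_cast; ring)
      (by omega) (by omega) (by omega)
  · exact mem_sumFourSqWith_two (M := 96 * l + 59) 2 (by rw [one_pow]; push_cast; ring)
      (by omega) (by omega) (by omega)

theorem exists_mem_sumFourSqWith_two_three (n : ℕ) :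
    ∃ t : ℤ, (n : ℤ) ∈ sumFourSqWith 2 (3 * t ^ 2) := by
  refine exists_mem_sumFourSqWith_two 3 2 (.inl rfl) (fun l => ⟨1, ?_⟩) (fun l => ⟨2, ?_⟩)
    (by omega) n
  · exact mem_sumFourSqWith_two (M := 96 * l + 51) 0 (by push_cast; ring)
      (by omega) (by omega) (by omega)
  · exact mem_sumFourSqWith_two (M := 24 * l + 6) 2 (by push_cast; ring)
      (by omega) (by omega) (by omega)

theorem exists_mem_sumFourSqWith_two_six (n : ℕ) :
    ∃ t : ℤ, (n : ℤ) ∈ sumFourSqWith 2 (6 * t ^ 2) := by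
  refine exists_mem_sumFourSqWith_two 6 2 (.inl rfl) (fun l => ⟨1, ?_⟩) (fun l => ⟨1, ?_⟩)
    (by omega) n
  · exact mem_sumFourSqWith_two (M := 24 * l + 6) 1 (by push_cast; ring)
      (by omega) (by omega) (by omega)
  · exact mem_sumFourSqWith_two (M := 96 * l + 51) 1 (by push_cast; ring)
      (by omega) (by omega) (by omega)

/-! ### Parts (ii) and (iii) -/

theorem sq_emod_five (a : ℤ) : a % 5 = 0 ∧ a ^ 2 % 5 = 0 ∨
    (a % 5 = 1 ∨ a % 5 = 4) ∧ a ^ 2 % 5 = 1 ∨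
    (a % 5 = 2 ∨ a % 5 = 3) ∧ a ^ 2 % 5 = 4 := by
  rcases (by omega : a % 5 = 0 ∨ a % 5 = 1 ∨ a % 5 = 2 ∨ a % 5 = 3 ∨ a % 5 = 4)
    with h | h | h | h | h <;> simp [pow_two, Int.mul_emod, h]

/-- If `5` divides a sum of two squares, the quotient is a sum of two squares. -/
theorem exists_five_mul_of_dvd {p q : ℤ} (h : (p ^ 2 + q ^ 2) % 5 = 0) :
    ∃ a b : ℤ, p ^ 2 + q ^ 2 = 5 * (a ^ 2 + b ^ 2) := by
  -- The sign of q is chosen so that p + qi is divisible by a Gaussian prime of norm 5.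
  obtain ⟨q', hq, hq'⟩ : ∃ q' : ℤ, q' ^ 2 = q ^ 2 ∧ (q' - 2 * p) % 5 = 0 := by
    have hp := sq_emod_five p
    have hq := sq_emod_five q
    by_cases h2 : (q - 2 * p) % 5 = 0
    · exact ⟨q, rfl, h2⟩
    · refine ⟨-q, by ring, ?_⟩
      omega
  obtain ⟨a, ha⟩ := Int.dvd_of_emod_eq_zero hq'
  refine ⟨p + 2 * a, a, ?_⟩
  rw [← hq]
  obtain rfl : q' = 5 * a + 2 * p := by linarith
  ring

/-- Squares mod 5 are 0 and ±1, so three summing to 0 include a 0. -/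
theorem exists_of_isSumThreeSq_five_mul {n : ℤ} (h : IsSumThreeSq (5 * n)) :
    ∃ a b c : ℤ, n = a ^ 2 + b ^ 2 + 5 * c ^ 2 := by
  have key : ∀ A B C : ℤ, 5 * n = A ^ 2 + B ^ 2 + C ^ 2 → C % 5 = 0 →
      ∃ a b c : ℤ, n = a ^ 2 + b ^ 2 + 5 * c ^ 2 := by
    intro A B C h hC
    obtain ⟨c, rfl⟩ := Int.dvd_of_emod_eq_zero hC
    obtain ⟨a, b, hab⟩ := exists_five_mul_of_dvd (p := A) (q := B)
      (Int.emod_eq_zero_of_dvd ⟨n - 5 * c ^ 2, by linarith⟩)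
    exact ⟨a, b, c, by linarith⟩
  obtain ⟨X, Y, Z, h⟩ := h
  have hcase : X % 5 = 0 ∨ Y % 5 = 0 ∨ Z % 5 = 0 := by
    have := sq_emod_five X
    have := sq_emod_five Y
    have := sq_emod_five Z
    omega
  rcases hcase with h0 | h0 | h0
  · exact key Y Z X (by linarith) h0
  · exact key X Z Y (by linarith) h0
  · exact key X Y Z h h0

theorem exists_of_isSumThreeSq_of_emod_five {n : ℤ} (hn : n % 5 = 1) (h : IsSumThreeSq n) :
    ∃ u a b : ℤ, n = u ^ 2 + 5 * (a ^ 2 + b ^ 2) ∧ u % 5 = 1 := by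
  have key : ∀ A B C : ℤ, n = A ^ 2 + B ^ 2 + C ^ 2 → A ^ 2 % 5 = 1 →
      ∃ u a b : ℤ, n = u ^ 2 + 5 * (a ^ 2 + b ^ 2) ∧ u % 5 = 1 := by
    intro A B C h hA
    obtain ⟨a, b, hab⟩ := exists_five_mul_of_dvd (p := B) (q := C) (by omega)
    have := sq_emod_five A
    rcases (by omega : A % 5 = 1 ∨ A % 5 = 4) with h1 | h1
    · exact ⟨A, a, b, by linarith, h1⟩
    · exact ⟨-A, a, b, by rw [neg_sq]; linarith, by omega⟩
  obtain ⟨X, Y, Z, h⟩ := h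
  have hcase : X ^ 2 % 5 = 1 ∨ Y ^ 2 % 5 = 1 ∨ Z ^ 2 % 5 = 1 := by
    have := sq_emod_five X
    have := sq_emod_five Y
    have := sq_emod_five Z
    omega
  rcases hcase with h0 | h0 | h0
  · exact key X Y Z h h0
  · exact key Y X Z (by linarith) h0
  · exact key Z X Y (by linarith) h0

/-- 5N fails to be a sum of three squares only for N = 4^j(8l+3), here with j ≤ 1; then 5N − 4 is
one. The two cases give x+3y = 0 and x+3y = 4. -/
theorem exists_oneThree_two_mul (N : ℕ) (hN : N % 8 ≠ 0) : ∃ x y z w : ℤ,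
    (2 * N : ℤ) = x ^ 2 + y ^ 2 + z ^ 2 + w ^ 2 ∧ IsSquare (x + 3 * y) := by
  have hcase : IsSumThreeSq (5 * N) ∨ IsSumThreeSq (5 * N - 4) := by
    by_cases h4 : N % 4 = 0
    · by_cases h3 : N / 4 % 8 = 3
      · exact .inr (isSumThreeSq_of_eq_four_pow_mul (M := 5 * (N / 4) - 1) 1 (by omega) (by omega)
          (by omega) (by omega))
      · exact .inl (isSumThreeSq_of_eq_four_pow_mul (M := 5 * (N / 4)) 1 (by omega) (by omega)
          (by omega) (by omega))
    · by_cases h3 : N % 8 = 3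
      · exact .inr (isSumThreeSq_of_mod_eight _ (by omega) (by omega) (by omega))
      · exact .inl (isSumThreeSq_of_mod_eight _ (by omega) (by omega) (by omega))
  rcases hcase with h | h
  · obtain ⟨a, b, c, h⟩ := exists_of_isSumThreeSq_five_mul h
    exact ⟨3 * c, -c, a + b, a - b, by rw [h]; ring, 0, by ring⟩
  · obtain ⟨u, a, b, h, hu⟩ := exists_of_isSumThreeSq_of_emod_five (by omega) h
    obtain ⟨k, rfl⟩ : ∃ k, u = 5 * k + 1 := ⟨u / 5, by omega⟩
    exact ⟨1 + 3 * k, 1 - k, a + b, a - b, by linarith, 2, by ring⟩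

theorem exists_oneThree
    (H : ∀ n : ℤ, Odd n → 2719 < n → ∃ x y z : ℤ, n = x ^ 2 + y ^ 2 + 10 * z ^ 2) (n : ℕ) :
    ∃ x y z w : ℤ, (n : ℤ) = x ^ 2 + y ^ 2 + z ^ 2 + w ^ 2 ∧ IsSquare (x + 3 * y) := by
  refine forall_nat_of_not_dvd (P := fun n => ∃ x y z w : ℤ,
    (n : ℤ) = x ^ 2 + y ^ 2 + z ^ 2 + w ^ 2 ∧ IsSquare (x + 3 * y)) 16 (by norm_num)
    ⟨0, 0, 0, 0, by simp, 0, by simp⟩ ?_ (fun n hn => ?_) n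
  · rintro n ⟨x, y, z, w, hn, t, ht⟩
    exact ⟨4 * x, 4 * y, 4 * z, 4 * w, by push_cast; rw [hn]; ring, 2 * t, by linarith⟩
  · rcases Nat.even_or_odd' n with ⟨N, rfl | rfl⟩
    · simpa using exists_oneThree_two_mul N (by omega)
    · by_cases hlt : 2 * N + 1 < 2720
      · exact exists_oneThree_of_lt _ hlt
      · obtain ⟨x, y, z, h⟩ := H (2 * N + 1 : ℕ) ⟨N, by push_cast; ring⟩ (by omega)
        exact ⟨3 * z, -z, x, y, by rw [h]; ring, 0, by ring⟩

theorem exists_oneThreeFive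
    (H : ∀ n : ℤ, 1190 ≤ n → ¬ (16 ∣ n) → ∃ r x y z : ℤ,
      7 * n = 7 * (x ^ 2 + 10 * y ^ 2) + (2 * z ^ 2 + 125 * r ^ 4)) (n : ℕ) :
    ∃ x y z w : ℤ, (n : ℤ) = x ^ 2 + y ^ 2 + z ^ 2 + w ^ 2 ∧ IsSquare (x + 3 * y + 5 * z) := by
  refine forall_nat_of_not_dvd (P := fun n => ∃ x y z w : ℤ,
    (n : ℤ) = x ^ 2 + y ^ 2 + z ^ 2 + w ^ 2 ∧ IsSquare (x + 3 * y + 5 * z)) 16 (by norm_num)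
    ⟨0, 0, 0, 0, by simp, 0, by simp⟩ ?_ (fun n hn => ?_) n
  · rintro n ⟨x, y, z, w, hn, t, ht⟩
    exact ⟨4 * x, 4 * y, 4 * z, 4 * w, by push_cast; rw [hn]; ring, 2 * t, by linarith⟩
  · by_cases hlt : n < 1190
    · exact exists_oneThreeFive_of_lt n hlt
    obtain ⟨r, X, Y, Z, h⟩ := H n (by omega) (by omega)
    -- Modulo 7 the hypothesis gives (25r²)² ≡ (2Z)², so one sign of Z works.
    obtain ⟨Z, h, hZ⟩ : ∃ Z : ℤ,
        7 * (n : ℤ) = 7 * (X ^ 2 + 10 * Y ^ 2) + (2 * Z ^ 2 + 125 * r ^ 4) ∧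
        (7 : ℤ) ∣ 25 * r ^ 2 - 2 * Z := by
      have hd : (7 : ℤ) ∣ (25 * r ^ 2 - 2 * Z) * (25 * r ^ 2 - 2 * -Z) :=
        ⟨125 * r ^ 4 - 2 * (n - X ^ 2 - 10 * Y ^ 2), by linear_combination 2 * h⟩
      rcases Int.Prime.dvd_mul' (p := 7) (by norm_num) hd with h7 | h7
      · exact ⟨Z, h, h7⟩
      · exact ⟨-Z, by rw [neg_sq]; exact h, h7⟩
    obtain ⟨z, hz⟩ := hZ
    obtain ⟨k, hk⟩ : (5 : ℤ) ∣ Z + z := by omega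
    obtain rfl : Z = 5 * k - z := by linarith
    have hr : 25 * r ^ 2 = 10 * k + 5 * z := by linarith
    -- (3Y+k)² + (3k−Y)² = 10Y² + 10k², and x+3y+5z = 10k + 5z = (5r)².
    refine ⟨3 * Y + k, 3 * k - Y, z, X, ?_, 5 * r, by linarith⟩
    have hr2 : 5 * r ^ 2 = 2 * k + z := by linarith
    have h7 : 7 * (n : ℤ) = 7 * ((3 * Y + k) ^ 2 + (3 * k - Y) ^ 2 + z ^ 2 + X ^ 2) := by
      linear_combination h + 5 * (5 * r ^ 2 + 2 * k + z) * hr2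
    linarith

theorem exists_mem_sumFourSqWith_of_mem_admissiblePairs (m : ℕ) (hm : m = 2 ∨ m = 3) (c d : ℤ)
    (h : (c, d) ∈ admissiblePairs m) (n : ℕ) :
    ∃ t : ℤ, (n : ℤ) ∈ sumFourSqWith c (d * t ^ m) := by
  have key : ((c, d) : ℤ × ℤ) ∈ ({(1, 1), (1, 2), (2, 1), (2, 2), (2, 4)} : Set (ℤ × ℤ)) →
      ∃ t : ℤ, (n : ℤ) ∈ sumFourSqWith c (d * t ^ m) := by
    intro h
    simp only [Set.mem_insert_iff, Set.mem_singleton_iff, Prod.mk.injEq] at h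
    rcases h with ⟨rfl, rfl⟩ | ⟨rfl, rfl⟩ | ⟨rfl, rfl⟩ | ⟨rfl, rfl⟩ | ⟨rfl, rfl⟩
    · exact exists_mem_sumFourSqWith_one_one m hm n
    · exact exists_mem_sumFourSqWith_one_two m hm n
    · exact exists_mem_sumFourSqWith_two_one m hm n
    · exact exists_mem_sumFourSqWith_two_two m hm n
    · exact exists_mem_sumFourSqWith_two_four m hm n
  rcases hm with rfl | rfl
  · rcases h with h | h
    · exact key h
    · simp only [Set.mem_insert_iff, Set.mem_singleton_iff, Prod.mk.injEq] at h
      rcases h with ⟨rfl, rfl⟩ | ⟨rfl, rfl⟩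
      · exact exists_mem_sumFourSqWith_two_three n
      · exact exists_mem_sumFourSqWith_two_six n
  · exact key h

theorem theorem1p3 :
    -- part (i)
    (∀ m : ℕ, m ∈ ({2, 3} : Set ℕ) → ∀ c d : ℤ, (c, d) ∈ admissiblePairs m →
      ∀ n : ℕ, ∃ x y z w : ℤ,
        (n : ℤ) = x ^ 2 + y ^ 2 + z ^ 2 + w ^ 2 ∧ ∃ t : ℤ, x + y + c * z = d * t ^ m) ∧
    -- part (ii)
    ((∀ n : ℤ, Odd n → 2719 < n → ∃ x y z : ℤ, n = x ^ 2 + y ^ 2 + 10 * z ^ 2) →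
      ∀ n : ℕ, ∃ x y z w : ℤ,
        (n : ℤ) = x ^ 2 + y ^ 2 + z ^ 2 + w ^ 2 ∧ IsSquare (x + 3 * y)) ∧
    -- part (iii); the quotient by 7 is taken in the rational numbers
    ((∀ n : ℤ, 1190 ≤ n → ¬ (16 ∣ n) → ∃ r ∈ ({0, 1, 2, 3} : Set ℤ), ∃ x y z : ℤ,
        (n : ℚ) = (x : ℚ) ^ 2 + 10 * (y : ℚ) ^ 2
          + (2 * (z : ℚ) ^ 2 + 5 ^ 3 * (r : ℚ) ^ 4) / 7) →
      ∀ n : ℕ, ∃ x y z w : ℤ,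
        (n : ℤ) = x ^ 2 + y ^ 2 + z ^ 2 + w ^ 2 ∧ IsSquare (x + 3 * y + 5 * z)) := by
  refine ⟨fun m hm c d hcd n => ?_, exists_oneThree, fun H => exists_oneThreeFive ?_⟩
  · obtain ⟨t, x, y, z, w, hn, hs⟩ :=
      exists_mem_sumFourSqWith_of_mem_admissiblePairs m (by simpa using hm) c d hcd n
    exact ⟨x, y, z, w, hn, t, hs⟩
  · intro n hn h16
    obtain ⟨r, -, x, y, z, h⟩ := H n hn h16
    refine ⟨r, x, y, z, ?_⟩
    qify
    linarith
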